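/- Let $\lambda,\nu,\tilde\lambda,\tilde\nu:\mathbb N\to[0,\infty)$ satisfy $\nu_0=\tilde\nu_0=0$. A birth-death process on $\mathbb N=\{0,1,2,\dots\}$ with birth rates $\lambda$ and death rates $\nu$ is an $\mathbb N$-valued Markov process $(X_t)_{t\ge 0}$ (Markov with respect to its own filtration) whose transition probabilities $P_t^x(y)$ form a Markov semigroup ($\sum_y P_t^x(y)=1$, $P_0^x(x)=1$, Chapman--Kolmogorov) such that, for every $x$, as $t\to0^+$, \[ P_t^x(x+1)=\lambda_x t+o(t),\qquad P_t^x(x-1)=\nu_x t+o(t)\ \ (x\ge 1),\qquad P_t^x(x)=1-(\lambda_x+\nu_x)t+o(t). \] Assume that the rates $(\lambda,\nu)$ are non-explosive, i.e. the minimal nonnegative solution of the associated Kolmogorov equations has total mass $1$ at all times and from all starting points. Let $x\in\mathbb N$, and let $(X_t^x)_{t\ge0}$ and $(\tilde X_t^x)_{t\ge0}$ be birth-death processes, possibly on different probability spaces, both started from $x$, with rates $(\lambda,\nu)$ and $(\tilde\lambda,\tilde\nu)$ respectively. If \[ \tilde\lambda_n\le\lambda_n\quad\text{and}\quad\tilde\nu_n\ge\nu_n\qquad\text{for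 all } n\in\mathbb N, \] then for every $t\ge0$ the random variable $\tilde X_t^x$ is stochastically smaller than $X_t^x$ (written $\tilde X_t^x\le_d X_t^x$): for every nonnegative nondecreasing function $f:\mathbb N\to\mathbb R$, \[ \mathbb E[f(\tilde X_t^x)]\le\mathbb E[f(X_t^x)]\quad\text{in }[0,\infty]. \] -/

import Mathlib

open MeasureTheory ProbabilityTheory Filter Topology Asymptotics
open scoped NNReal ENNReal

/-- Birth rates and death rates on `ℕ`; there is no death at `0`. -/
structure BirthDeathRates where
  birth : ℕ → ℝ≥0
  death : ℕ → ℝ≥0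
  death_zero : death 0 = 0

namespace BirthDeathRates

/-- Feller's iteration for the backward Kolmogorov equation: `R.fellerIter y n t x` is the
probability that the minimal (jump and hold) process with rates `R`, started at `x`, is at `y` at
time `t` after having made fewer than `n` jumps. The recursion conditions on the first jump. -/
noncomputable def fellerIter (R : BirthDeathRates) (y : ℕ) : ℕ → ℝ → ℕ → ℝ≥0∞
  | 0, _, _ => 0
  | n + 1, t, x =>
      (if x = y then ENNReal.ofReal (Real.exp (-((R.birth x : ℝ) + R.death x) * t)) else 0)
        + ∫⁻ s in Set.Icc 0 t,
            ENNReal.ofReal (Real.exp (-((R.birth x : ℝ) + R.death x) * s)) *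
              (R.birth x * fellerIter R y n (t - s) (x + 1)
                + R.death x * fellerIter R y n (t - s) (x - 1))

/-- The minimal nonnegative solution of the Kolmogorov equations: the probability that the minimal
process with rates `R`, started at `x`, has not exploded by time `t` and is then at `y`. -/
noncomputable def minimalTransition (R : BirthDeathRates) (t : ℝ≥0) (x y : ℕ) : ℝ≥0∞ :=
  ⨆ n : ℕ, R.fellerIter y n t x

/-- The rates are non-explosive when the minimal process loses no mass in finite time. -/
def NonExplosive (R : BirthDeathRates) : Prop :=
  ∀ (t : ℝ≥0) (x : ℕ), ∑' y : ℕ, R.minimalTransition t x y = 1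

/-- `P` is a (stochastic) Markov semigroup of transition kernels on `ℕ` with birth rates `R.birth`
and death rates `R.death`: as `t → 0+`,
`P t x {x + 1} = R.birth x * t + o(t)`, `P t x {x - 1} = R.death x * t + o(t)` for `x ≥ 1`, and
`P t x {x} = 1 - (R.birth x + R.death x) * t + o(t)`. -/
structure IsTransitionSemigroup (R : BirthDeathRates) (P : ℝ≥0 → Kernel ℕ ℕ) : Prop where
  markov : ∀ t, IsMarkovKernel (P t)
  zero : P 0 = Kernel.id
  add : ∀ s t, P (s + t) = P t ∘ₖ P s
  birth : ∀ x : ℕ, (fun t : ℝ≥0 => (P t x).real {x + 1} - R.birth x * t)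
    =o[𝓝[>] 0] (fun t : ℝ≥0 => (t : ℝ))
  death : ∀ x : ℕ, (fun t : ℝ≥0 => (P t (x + 1)).real {x} - R.death (x + 1) * t)
    =o[𝓝[>] 0] (fun t : ℝ≥0 => (t : ℝ))
  stay : ∀ x : ℕ, (fun t : ℝ≥0 => (P t x).real {x} - (1 - ((R.birth x : ℝ) + R.death x) * t))
    =o[𝓝[>] 0] (fun t : ℝ≥0 => (t : ℝ))

/-- `X` is a birth-death process on `ℕ` with rates `R`, started at `x`: a Markov process, with
respect to its own filtration, whose transition probabilities form a semigroup with rates `R`. -/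
structure IsProcessFrom (R : BirthDeathRates) (x : ℕ) {Ω : Type*} [MeasurableSpace Ω]
    (μ : Measure Ω) (X : ℝ≥0 → Ω → ℕ) : Prop where
  measurable : ∀ t, Measurable (X t)
  start : ∀ᵐ ω ∂μ, X 0 ω = x
  markov : ∃ P : ℝ≥0 → Kernel ℕ ℕ, R.IsTransitionSemigroup P ∧
    ∀ (s t : ℝ≥0) (y : ℕ),
      μ[(X (s + t) ⁻¹' {y}).indicator (fun _ => (1 : ℝ)) |
          ⨆ u : Set.Iic s, MeasurableSpace.comap (X u) inferInstance]
        =ᵐ[μ] fun ω => (P t (X s ω)).real {y}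

end BirthDeathRates

/-- `X` (defined under `μ`) is stochastically smaller than `Y` (defined under `ν`):
`E f(X) ≤ E f(Y)` in `[0, ∞]` for every nonnegative nondecreasing `f : ℕ → ℝ`. -/
def StochasticallySmaller {Ω Ω' : Type*} [MeasurableSpace Ω] [MeasurableSpace Ω']
    (μ : Measure Ω) (X : Ω → ℕ) (ν : Measure Ω') (Y : Ω' → ℕ) : Prop :=
  ∀ f : ℕ → ℝ, (∀ n, 0 ≤ f n) → Monotone f →
    ∫⁻ ω, ENNReal.ofReal (f (X ω)) ∂μ ≤ ∫⁻ ω, ENNReal.ofReal (f (Y ω)) ∂ν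

/-! Kill the process with the larger birth rates on reaching `N`, and let `u t x` be the probability
that, from `x`, it is alive and below `n` at time `t`. A higher start is both further from `{0, …,
n-1}` and closer to the killing level, so `u t` is nonincreasing in `x` (`killedSemigroup_succ_le`).
On nonincreasing functions the generator grows when births slow down and deaths speed up
(`generator_le_of_rates_le`). Hence `u` is a subsolution of the backward equation for the rates `R'`
below `N`, and an Euler scheme (`operatorSemigroup_le`) shows that every transition semigroup with
rates `R'` dominates it.

As `N → ∞`, `u` controls the minimal solution for `R` (`sum_minimalTransition_le`). Non-explosion
makes that solution the only transition semigroup with rates `R` (`measure_singleton_eq`). Only a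
lower bound is needed on the `R'` side, so those rates may explode and their semigroup need not be
unique. -/

open NormedSpace BoundedContinuousFunction

/-! ### Semigroups of bounded operators and invariant cones -/

section OperatorSemigroup

variable {E : Type*} [NormedAddCommGroup E] [NormedSpace ℝ E]

/-- The norm-continuous semigroup generated by a bounded operator. -/
noncomputable def operatorSemigroup (G : E →L[ℝ] E) (t : ℝ) : E →L[ℝ] E :=
  exp (t • G)

theorem operatorSemigroup_zero (G : E →L[ℝ] E) : operatorSemigroup G 0 = 1 := by
  rw [operatorSemigroup, zero_smul, exp_zero]

variable [CompleteSpace E]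

theorem hasSum_operatorSemigroup_apply (G : E →L[ℝ] E) (t : ℝ) (f : E) :
    HasSum (fun n : ℕ => (n.factorial : ℝ)⁻¹ • ((t • G) ^ n) f) (operatorSemigroup G t f) := by
  have h := exp_series_hasSum_exp' (𝕂 := ℝ) (t • G)
  exact h.mapL (ContinuousLinearMap.apply ℝ E f)

theorem operatorSemigroup_add (G : E →L[ℝ] E) (s t : ℝ) (f : E) :
    operatorSemigroup G (s + t) f = operatorSemigroup G s (operatorSemigroup G t f) := by
  let +nondep : NormedAlgebra ℚ (E →L[ℝ] E) := .restrictScalars ℚ ℝ _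
  rw [operatorSemigroup, add_smul,
    exp_add_of_commute (((Commute.refl G).smul_left s).smul_right t)]
  rfl

theorem operatorSemigroup_add_smul_one (G : E →L[ℝ] E) (c t : ℝ) :
    operatorSemigroup (G + c • (1 : E →L[ℝ] E)) t = Real.exp (t * c) • operatorSemigroup G t := by
  let +nondep : NormedAlgebra ℚ (E →L[ℝ] E) := .restrictScalars ℚ ℝ _
  have hcomm : Commute (t • G) ((t * c) • (1 : E →L[ℝ] E)) :=
    (Commute.one_right _).smul_right _
  have hscalar : exp ((t * c) • (1 : E →L[ℝ] E)) = Real.exp (t * c) • (1 : E →L[ℝ] E) := by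
    have h := algebraMap_exp_comm (𝔸 := E →L[ℝ] E) (t * c)
    rw [Algebra.algebraMap_eq_smul_one, Algebra.algebraMap_eq_smul_one] at h
    rw [← h, Real.exp_eq_exp_ℝ]
  rw [operatorSemigroup, smul_add, smul_smul, exp_add_of_commute hcomm, hscalar, mul_smul_comm,
    mul_one, operatorSemigroup]

/-- The semigroup generated by an operator that preserves a closed convex cone up to a multiple of
the identity preserves that cone. -/
theorem operatorSemigroup_apply_mem {S : Set E} (hclosed : IsClosed S)
    (hzero : (0 : E) ∈ S) (hadd : ∀ f ∈ S, ∀ g ∈ S, f + g ∈ S)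
    (hsmul : ∀ r : ℝ, 0 ≤ r → ∀ f ∈ S, r • f ∈ S) {G : E →L[ℝ] E} {c : ℝ}
    (hG : ∀ f ∈ S, G f + c • f ∈ S) {f : E} (hf : f ∈ S) {t : ℝ} (ht : 0 ≤ t) :
    operatorSemigroup G t f ∈ S := by
  -- Since `G + c` preserves the cone, so does each term of its exponential series; the factor `exp
  -- (t * c)` is removed at the end.
  have hpow : ∀ n : ℕ, ((t • (G + c • (1 : E →L[ℝ] E))) ^ n) f ∈ S := by
    intro n
    induction n with
    | zero => simpa using hf
    | succ n ih =>
      rw [pow_succ']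
      exact hsmul t ht _ (hG _ ih)
  have hmem : operatorSemigroup (G + c • (1 : E →L[ℝ] E)) t f ∈ S := by
    refine hclosed.mem_of_tendsto (hasSum_operatorSemigroup_apply _ t f)
      (Eventually.of_forall fun s => ?_)
    induction s using Finset.cons_induction with
    | empty => simpa using hzero
    | cons a s ha ih =>
      rw [Finset.sum_cons]
      exact hadd _ (hsmul _ (by positivity) _ (hpow a)) _ ih
  have hscale := hsmul (Real.exp (-(t * c))) (Real.exp_pos _).le _ hmem
  rw [operatorSemigroup_add_smul_one] at hscale
  simpa [smul_smul, ← Real.exp_add] using hscale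

theorem hasDerivAt_operatorSemigroup_apply (G : E →L[ℝ] E) (f : E) (t : ℝ) :
    HasDerivAt (fun s : ℝ => operatorSemigroup G s f) (G (operatorSemigroup G t f)) t := by
  have h := hasDerivAt_exp_smul_const' (𝕂 := ℝ) G t
  exact (ContinuousLinearMap.apply ℝ E f).hasFDerivAt.comp_hasDerivAt t h

/-- The Euler step approximates the semigroup to first order. -/
theorem eventually_norm_operatorSemigroup_sub_le (G : E →L[ℝ] E) {ε : ℝ} (hε : 0 < ε) :
    ∀ᶠ h : ℝ≥0 in 𝓝[>] 0, ‖operatorSemigroup G h - 1 - (h : ℝ) • G‖ ≤ ε * h := by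
  have hd : HasDerivAt (operatorSemigroup G) G 0 := by
    have h := hasDerivAt_exp_smul_const (𝕂 := ℝ) G 0
    rwa [zero_smul, exp_zero, one_mul] at h
  rw [hasDerivAt_iff_isLittleO_nhds_zero] at hd
  have hlim : Tendsto (fun h : ℝ≥0 => (h : ℝ)) (𝓝[>] 0) (𝓝 0) :=
    (NNReal.continuous_coe.tendsto' 0 0 (by simp)).mono_left nhdsWithin_le_nhds
  filter_upwards [hlim.eventually (hd.def hε)] with h hh
  simpa [operatorSemigroup_zero] using hh

end OperatorSemigroup

/-! ### The killed generator and the cones its semigroup preserves -/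

namespace BirthDeathRates

/-- The formal generator of a birth-death process. -/
noncomputable def generator (R : BirthDeathRates) (f : ℕ → ℝ) (x : ℕ) : ℝ :=
  R.birth x * (f (x + 1) - f x) + R.death x * (f (x - 1) - f x)

/-- The generator of the process killed on reaching `N`, as a bounded operator. -/
noncomputable def killedGenerator (R : BirthDeathRates) (N : ℕ) : (ℕ →ᵇ ℝ) →L[ℝ] (ℕ →ᵇ ℝ) :=
  ∑ x ∈ Finset.range N,
    ContinuousLinearMap.smulRight
      ((R.birth x : ℝ) • (evalCLM ℝ (x + 1) - evalCLM ℝ x)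
        + (R.death x : ℝ) • (evalCLM ℝ (x - 1) - evalCLM ℝ x) : (ℕ →ᵇ ℝ) →L[ℝ] ℝ)
        (BoundedContinuousFunction.indicator {x} (isClopen_discrete _))

theorem killedGenerator_apply (R : BirthDeathRates) (N : ℕ) (f : ℕ →ᵇ ℝ) (x : ℕ) :
    R.killedGenerator N f x = if x < N then R.generator f x else 0 := by
  have hterm : ∀ z, (ContinuousLinearMap.smulRight
      ((R.birth z : ℝ) • (evalCLM ℝ (z + 1) - evalCLM ℝ z)
        + (R.death z : ℝ) • (evalCLM ℝ (z - 1) - evalCLM ℝ z) : (ℕ →ᵇ ℝ) →L[ℝ] ℝ)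
        (BoundedContinuousFunction.indicator {z} (isClopen_discrete _)) f) x
      = if x = z then R.generator f z else 0 := by
    intro z
    by_cases hxz : x = z
    · subst hxz
      simp [generator, evalCLM, BoundedContinuousFunction.indicator]
    · simp [evalCLM, BoundedContinuousFunction.indicator, hxz]
  rw [killedGenerator, _root_.sum_apply, BoundedContinuousFunction.sum_apply]
  simp_rw [hterm]
  simp

/-- A constant dominating the total rates of two neighbouring states below `N`. -/
noncomputable def rateBound (R : BirthDeathRates) (N : ℕ) : ℝ :=
  ∑ x ∈ Finset.range (N + 1), ((R.birth x : ℝ) + R.death x)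

theorem rate_le_rateBound (R : BirthDeathRates) {N x : ℕ} (hx : x < N) :
    (R.birth x : ℝ) + R.death x ≤ R.rateBound N :=
  Finset.single_le_sum (f := fun x => (R.birth x : ℝ) + R.death x)
    (fun _ _ => by positivity) (Finset.mem_range.2 (hx.trans (Nat.lt_succ_self N)))

theorem birth_add_death_succ_le_rateBound (R : BirthDeathRates) {N x : ℕ} (hx : x < N) :
    (R.birth x : ℝ) + R.death (x + 1) ≤ R.rateBound N := by
  -- Here `x + 1` may equal `N`, so the sum must include the state `N`.
  have hsub : ({x, x + 1} : Finset ℕ) ⊆ Finset.range (N + 1) := by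
    intro y hy
    simp only [Finset.mem_insert, Finset.mem_singleton] at hy
    exact Finset.mem_range.2 (by omega)
  have := Finset.sum_le_sum_of_subset_of_nonneg (f := fun x => (R.birth x : ℝ) + R.death x) hsub
    (fun _ _ _ => by positivity)
  rw [Finset.sum_pair (by omega)] at this
  have h1 : (0 : ℝ) ≤ R.death x := by positivity
  have h2 : (0 : ℝ) ≤ R.birth (x + 1) := by positivity
  unfold rateBound
  linarith

theorem isClosed_setOf_nonneg_killed (N : ℕ) :
    IsClosed {f : ℕ →ᵇ ℝ | (∀ x, 0 ≤ f x) ∧ ∀ x, N ≤ x → f x = 0} := by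
  simp only [Set.ofPred_and, Set.ofPred_forall]
  have hc : ∀ x, Continuous fun f : ℕ →ᵇ ℝ => f x := fun x => continuous_eval_const x
  exact (isClosed_iInter fun x => isClosed_le continuous_const (hc x)).inter
    (isClosed_iInter fun x => isClosed_iInter fun _ => isClosed_eq (hc x) continuous_const)

theorem isClosed_setOf_antitone :
    IsClosed {f : ℕ →ᵇ ℝ | ∀ x, f (x + 1) ≤ f x} := by
  simp only [Set.ofPred_forall]
  have hc : ∀ x, Continuous fun f : ℕ →ᵇ ℝ => f x := fun x => continuous_eval_const x
  exact isClosed_iInter fun x => isClosed_le (hc _) (hc _)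

theorem killedGenerator_add_smul_nonneg (R : BirthDeathRates) (N : ℕ) {f : ℕ →ᵇ ℝ}
    (hf : ∀ x, 0 ≤ f x) (x : ℕ) :
    0 ≤ (R.killedGenerator N f + R.rateBound N • f) x := by
  have hc : 0 ≤ R.rateBound N := Finset.sum_nonneg fun _ _ => by positivity
  simp only [BoundedContinuousFunction.add_apply, BoundedContinuousFunction.smul_apply,
    killedGenerator_apply, smul_eq_mul]
  split_ifs with hx
  · have h1 := mul_nonneg (sub_nonneg.2 (R.rate_le_rateBound hx)) (hf x)
    have h2 : (0 : ℝ) ≤ R.birth x * f (x + 1) := mul_nonneg (by positivity) (hf _)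
    have h3 : (0 : ℝ) ≤ R.death x * f (x - 1) := mul_nonneg (by positivity) (hf _)
    simp only [generator]
    linarith
  · have := mul_nonneg hc (hf x)
    linarith

theorem killedGenerator_add_smul_eq_zero (R : BirthDeathRates) (N : ℕ) {f : ℕ →ᵇ ℝ}
    {x : ℕ} (hx : N ≤ x) (hf : f x = 0) :
    (R.killedGenerator N f + R.rateBound N • f) x = 0 := by
  simp [killedGenerator_apply, hf, hx.not_gt]

/-- In the difference of the two sides, `f x - f (x + 1)` has coefficient `c - birth x - death (x +
1)` with `c` the rate bound, and the other increments of `f` enter with nonnegative rates. At the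
killing level the upper value is `0`, which is why monotonicity is propagated together with
nonnegativity and vanishing from `N` on. -/
theorem killedGenerator_add_smul_succ_le (R : BirthDeathRates) (N : ℕ) {f : ℕ →ᵇ ℝ}
    (hnn : ∀ x, 0 ≤ f x) (hz : ∀ x, N ≤ x → f x = 0) (hf : ∀ x, f (x + 1) ≤ f x) (x : ℕ) :
    (R.killedGenerator N f + R.rateBound N • f) (x + 1)
      ≤ (R.killedGenerator N f + R.rateBound N • f) x := by
  by_cases hx : x + 1 < N
  · have hx' : x < N := by omega
    simp only [BoundedContinuousFunction.add_apply, BoundedContinuousFunction.smul_apply,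
      killedGenerator_apply, smul_eq_mul, hx, hx', if_true, generator, Nat.add_sub_cancel]
    have h1 := mul_nonneg (sub_nonneg.2 (R.birth_add_death_succ_le_rateBound hx'))
      (sub_nonneg.2 (hf x))
    have h2 : (0 : ℝ) ≤ R.birth (x + 1) * (f (x + 1) - f (x + 1 + 1)) :=
      mul_nonneg (by positivity) (sub_nonneg.2 (hf _))
    have h3 : (0 : ℝ) ≤ R.death x * (f (x - 1) - f x) := by
      refine mul_nonneg (by positivity) (sub_nonneg.2 ?_)
      cases x with
      | zero => simp
      | succ x => exact hf x
    linarith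
  · rw [R.killedGenerator_add_smul_eq_zero N (by omega) (hz _ (by omega))]
    exact R.killedGenerator_add_smul_nonneg N hnn x

/-- The semigroup of the process killed on reaching `N`. -/
noncomputable def killedSemigroup (R : BirthDeathRates) (N : ℕ) (t : ℝ) :
    (ℕ →ᵇ ℝ) →L[ℝ] (ℕ →ᵇ ℝ) :=
  operatorSemigroup (R.killedGenerator N) t

theorem killedSemigroup_mem (R : BirthDeathRates) (N : ℕ) {t : ℝ} (ht : 0 ≤ t) {f : ℕ →ᵇ ℝ}
    (hnn : ∀ x, 0 ≤ f x) (hz : ∀ x, N ≤ x → f x = 0) :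
    (∀ x, 0 ≤ R.killedSemigroup N t f x) ∧ ∀ x, N ≤ x → R.killedSemigroup N t f x = 0 := by
  refine operatorSemigroup_apply_mem
    (S := {f : ℕ →ᵇ ℝ | (∀ x, 0 ≤ f x) ∧ ∀ x, N ≤ x → f x = 0}) (c := R.rateBound N)
    (isClosed_setOf_nonneg_killed N) ⟨fun _ => le_rfl, fun _ _ => rfl⟩ ?_ ?_ ?_ ⟨hnn, hz⟩ ht
  · exact fun f hf g hg => ⟨fun x => add_nonneg (hf.1 x) (hg.1 x),
      fun x hx => by simp [hf.2 x hx, hg.2 x hx]⟩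
  · exact fun r hr f hf => ⟨fun x => mul_nonneg hr (hf.1 x), fun x hx => by simp [hf.2 x hx]⟩
  · exact fun f hf => ⟨R.killedGenerator_add_smul_nonneg N hf.1,
      fun x hx => R.killedGenerator_add_smul_eq_zero N hx (hf.2 x hx)⟩

theorem killedSemigroup_succ_le (R : BirthDeathRates) (N : ℕ) {t : ℝ} (ht : 0 ≤ t) {f : ℕ →ᵇ ℝ}
    (hnn : ∀ x, 0 ≤ f x) (hz : ∀ x, N ≤ x → f x = 0) (hf : ∀ x, f (x + 1) ≤ f x) (x : ℕ) :
    R.killedSemigroup N t f (x + 1) ≤ R.killedSemigroup N t f x := by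
  have hclosed := (isClosed_setOf_nonneg_killed N).inter isClosed_setOf_antitone
  refine (operatorSemigroup_apply_mem (c := R.rateBound N) (f := f) (t := t)
    (G := R.killedGenerator N) hclosed
    ⟨⟨fun _ => le_rfl, fun _ _ => rfl⟩, fun _ => le_rfl⟩ ?_ ?_ ?_ ⟨⟨hnn, hz⟩, hf⟩ ht).2 x
  · exact fun f hf g hg => ⟨⟨fun x => add_nonneg (hf.1.1 x) (hg.1.1 x),
      fun x hx => by simp [hf.1.2 x hx, hg.1.2 x hx]⟩, fun x => add_le_add (hf.2 x) (hg.2 x)⟩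
  · exact fun r hr f hf => ⟨⟨fun x => mul_nonneg hr (hf.1.1 x),
      fun x hx => by simp [hf.1.2 x hx]⟩, fun x => mul_le_mul_of_nonneg_left (hf.2 x) hr⟩
  · exact fun f hf => ⟨⟨R.killedGenerator_add_smul_nonneg N hf.1.1,
      fun x hx => R.killedGenerator_add_smul_eq_zero N hx (hf.1.2 x hx)⟩,
      R.killedGenerator_add_smul_succ_le N hf.1.1 hf.1.2 hf.2⟩

theorem generator_le_of_rates_le {R R' : BirthDeathRates} (hbirth : ∀ n, R'.birth n ≤ R.birth n)
    (hdeath : ∀ n, R.death n ≤ R'.death n) {f : ℕ → ℝ} (hf : ∀ x, f (x + 1) ≤ f x) (x : ℕ) :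
    R.generator f x ≤ R'.generator f x := by
  have h1 : ((R'.birth x : ℝ)) ≤ R.birth x := by exact_mod_cast hbirth x
  have h2 : ((R.death x : ℝ)) ≤ R'.death x := by exact_mod_cast hdeath x
  have h3 : f x ≤ f (x - 1) := by
    cases x with
    | zero => exact le_rfl
    | succ x => exact hf x
  have h4 := mul_nonneg (sub_nonneg.2 h1) (sub_nonneg.2 (hf x))
  have h5 := mul_nonneg (sub_nonneg.2 h2) (sub_nonneg.2 h3)
  simp only [generator]
  linarith

/-! ### Comparison of transition semigroups with subsolutions -/

namespace IsTransitionSemigroup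

variable {R : BirthDeathRates} {P : ℝ≥0 → Kernel ℕ ℕ}

theorem integrable (hP : R.IsTransitionSemigroup P) (t : ℝ≥0) (x : ℕ) (f : ℕ →ᵇ ℝ) :
    Integrable f (P t x) := by
  have := hP.markov t
  exact f.integrable _

theorem sum_le_integral (hP : R.IsTransitionSemigroup P) (t : ℝ≥0) (x : ℕ) {f : ℕ →ᵇ ℝ}
    (hf : ∀ y, 0 ≤ f y) (s : Finset ℕ) :
    ∑ y ∈ s, (P t x).real {y} * f y ≤ ∫ y, f y ∂P t x := by
  have h := setIntegral_le_integral (s := (s : Set ℕ)) (hP.integrable t x f)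
    (Eventually.of_forall hf)
  rw [setIntegral_finset s (hP.integrable t x f).integrableOn] at h
  simpa using h

/-- Over a short time, the transition kernel dominates the Euler step of the generator. -/
theorem eventually_euler_le_integral_at (hP : R.IsTransitionSemigroup P) (x : ℕ) {B ε : ℝ}
    (hB : 0 < B) (hε : 0 < ε) :
    ∀ᶠ h : ℝ≥0 in 𝓝[>] 0, ∀ f : ℕ →ᵇ ℝ, (∀ y, 0 ≤ f y) → ‖f‖ ≤ B →
      f x + h * R.generator f x - ε * h ≤ ∫ y, f y ∂P h x := by
  -- At most three target states are kept, each with error at most `ε / (3 * B) * h * B = ε / 3 *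
  -- h`.
  have hη : 0 < ε / (3 * B) := by positivity
  have key : ∀ (f : ℕ →ᵇ ℝ), (∀ y, 0 ≤ f y) → ‖f‖ ≤ B → ∀ (h : ℝ≥0) (p q : ℝ) (y : ℕ),
      ‖p - q‖ ≤ ε / (3 * B) * ‖(h : ℝ)‖ → q * f y - ε / 3 * h ≤ p * f y := by
    intro f hf hfB h p q y hpq
    have hle : f y ≤ B := ((le_abs_self _).trans (f.norm_coe_le_norm y)).trans hfB
    rw [Real.norm_eq_abs, Real.norm_of_nonneg (NNReal.coe_nonneg h)] at hpq
    have h1 : (q - p) * f y ≤ ε / (3 * B) * h * B :=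
      (mul_le_mul_of_nonneg_right ((le_abs_self _).trans ((abs_sub_comm q p).trans_le hpq))
        (hf y)).trans (mul_le_mul_of_nonneg_left hle (by positivity))
    have h2 : ε / (3 * B) * h * B = ε / 3 * h := by field_simp
    linarith
  cases x with
  | zero =>
    filter_upwards [(hP.birth 0).def hη, (hP.stay 0).def hη] with h hb hs f hf hfB
    have h0 := key f hf hfB h _ _ 1 hb
    have h1 := key f hf hfB h _ _ 0 hs
    have hsum := hP.sum_le_integral h 0 hf {0, 1}
    rw [Finset.sum_pair (by omega)] at hsum
    -- At `0` only two states contribute, and the third share of the error is slack.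
    have hd : (R.death 0 : ℝ) = 0 := by simp [R.death_zero]
    have hpos : 0 ≤ ε / 3 * (h : ℝ) := by positivity
    simp only [generator, hd] at *
    norm_num at *
    linarith
  | succ m =>
    filter_upwards [(hP.birth (m + 1)).def hη, (hP.stay (m + 1)).def hη, (hP.death m).def hη]
      with h hb hs hd f hf hfB
    have h0 := key f hf hfB h _ _ (m + 1 + 1) hb
    have h1 := key f hf hfB h _ _ (m + 1) hs
    have h2 := key f hf hfB h _ _ m hd
    have hsum := hP.sum_le_integral h (m + 1) hf {m, m + 1, m + 1 + 1}
    rw [Finset.sum_insert (by simp; omega), Finset.sum_pair (by omega)] at hsum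
    simp only [generator, Nat.add_sub_cancel]
    linarith

theorem eventually_euler_le_integral (hP : R.IsTransitionSemigroup P) (N : ℕ) {B ε : ℝ}
    (hB : 0 < B) (hε : 0 < ε) :
    ∀ᶠ h : ℝ≥0 in 𝓝[>] 0, ∀ x < N, ∀ f : ℕ →ᵇ ℝ, (∀ y, 0 ≤ f y) → ‖f‖ ≤ B →
      f x + h * R.generator f x - ε * h ≤ ∫ y, f y ∂P h x := by
  have h := (eventually_all_finset (Finset.range N)).2
    fun x _ => hP.eventually_euler_le_integral_at x hB hε
  filter_upwards [h] with h hh x hx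
  exact hh x (Finset.mem_range.2 hx)

theorem real_add_apply (hP : R.IsTransitionSemigroup P) (s t : ℝ≥0) (x : ℕ) (A : Set ℕ) :
    (P (s + t) x).real A = ∫ y, (P t y).real A ∂P s x := by
  have := hP.markov t
  rw [hP.add, Measure.real, Kernel.comp_apply' _ _ _ (MeasurableSet.of_discrete)]
  rw [integral_eq_lintegral_of_nonneg_ae (Eventually.of_forall fun _ => measureReal_nonneg)
    (Measurable.of_discrete.aestronglyMeasurable)]
  simp

/-- Comparison of a transition semigroup with a subsolution of its backward equation below `N`. -/
theorem operatorSemigroup_le (hP : R.IsTransitionSemigroup P) (G : (ℕ →ᵇ ℝ) →L[ℝ] (ℕ →ᵇ ℝ))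
    (N : ℕ) (A : Set ℕ) {f : ℕ →ᵇ ℝ} (hf : ∀ x, f x ≤ A.indicator 1 x)
    (hnn : ∀ t, 0 ≤ t → ∀ x, 0 ≤ operatorSemigroup G t f x)
    (hzero : ∀ t, 0 ≤ t → ∀ x, N ≤ x → operatorSemigroup G t f x = 0)
    (hgen : ∀ t, 0 ≤ t → ∀ x < N, G (operatorSemigroup G t f) x
      ≤ R.generator (operatorSemigroup G t f) x) (t : ℝ≥0) (x : ℕ) :
    operatorSemigroup G t f x ≤ (P t x).real A := by
  have hinit : ∀ x, operatorSemigroup G 0 f x ≤ (P 0 x).real A := by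
    intro x
    rw [operatorSemigroup_zero, hP.zero, Kernel.id_apply, Measure.real,
      Measure.dirac_apply' _ MeasurableSet.of_discrete]
    refine (hf x).trans_eq ?_
    by_cases hx : x ∈ A <;> simp [hx]
  rcases eq_or_ne t 0 with rfl | ht
  · exact hinit x
  have htpos : (0 : ℝ) < t := by exact_mod_cast pos_iff_ne_zero.2 ht
  obtain ⟨B, hB⟩ := (isCompact_Icc (a := (0 : ℝ)) (b := t)).exists_bound_of_continuousOn
    (f := fun s => operatorSemigroup G s f)
    fun s _ => (hasDerivAt_operatorSemigroup_apply G f s).continuousAt.continuousWithinAt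
  have hB1 : 0 < B + 1 := by
    have := (norm_nonneg _).trans (hB 0 ⟨le_rfl, htpos.le⟩)
    linarith
  refine le_of_forall_pos_le_add fun ε hε => ?_
  -- Each of the `m` steps loses `η * h` for the kernel and `η * h` for the operator semigroup, so
  -- the total loss is `2 * η * t = ε`.
  set η := ε / (2 * t) with hη_def
  have hη : 0 < η := by positivity
  have hδ : 0 < η / (B + 1) := by positivity
  have hlim : Tendsto (fun m : ℕ => t / (m : ℝ≥0)) atTop (𝓝[>] 0) := by
    refine tendsto_nhdsWithin_iff.2 ⟨tendsto_const_div_atTop_nhds_zero_nat t, ?_⟩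
    filter_upwards [eventually_gt_atTop 0] with m hm
    have : (0 : ℝ≥0) < m := by exact_mod_cast hm
    exact div_pos (pos_iff_ne_zero.2 ht) this
  obtain ⟨m, ⟨hstep, heuler⟩, hm⟩ := ((hlim.eventually
    ((hP.eventually_euler_le_integral N hB1 hη).and
      (eventually_norm_operatorSemigroup_sub_le G hδ))).and (eventually_gt_atTop 0)).exists
  set h : ℝ≥0 := t / (m : ℝ≥0) with hh
  have hmh : (m : ℝ≥0) * h = t := mul_div_cancel₀ _ (by exact_mod_cast hm.ne')
  have hmhR : (m : ℝ) * (h : ℝ) = t := by exact_mod_cast hmh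
  -- The first step of length `h` is split off by Chapman–Kolmogorov and the induction hypothesis is
  -- integrated against `P h x`. Hence it must cover all states, including those from `N` on, where
  -- the left side is nonpositive.
  have hind : ∀ k ≤ m, ∀ x, operatorSemigroup G (k * h : ℝ) f x - k * (2 * η * h)
      ≤ (P (k * h) x).real A := by
    intro k
    induction k with
    | zero =>
      intro _ x
      simpa using hinit x
    | succ k ih =>
      intro hk x
      have hk0 : (0 : ℝ) ≤ k * h := by positivity
      have hkt : (k * h : ℝ) ≤ t := by
        rw [← hmhR]
        exact mul_le_mul_of_nonneg_right (by exact_mod_cast (Nat.le_succ k).trans hk) h.2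
      rcases lt_or_ge x N with hx | hx
      · set v := operatorSemigroup G (k * h : ℝ) f with hv
        have hvB : ‖v‖ ≤ B + 1 := (hB _ ⟨hk0, hkt⟩).trans (by linarith)
        have hv1 : operatorSemigroup G ((k + 1 : ℕ) * h : ℝ) f = operatorSemigroup G h v := by
          rw [hv, ← operatorSemigroup_add]
          push_cast
          ring_nf
        have hP1 : (P ((k + 1 : ℕ) * h) x).real A = ∫ y, (P (k * h) y).real A ∂P h x := by
          rw [← hP.real_add_apply]
          congr 3
          push_cast
          ring
        have e1 : operatorSemigroup G h v x ≤ v x + h * G v x + η * h := by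
          have e2 : ‖(operatorSemigroup G h - 1 - (h : ℝ) • G) v‖ ≤ η * h := by
            refine (ContinuousLinearMap.le_of_opNorm_le _ heuler v).trans ?_
            calc η / (B + 1) * h * ‖v‖ ≤ η / (B + 1) * h * (B + 1) := by gcongr
              _ = η * h := by field_simp
          have e3 : operatorSemigroup G h v x - v x - h * G v x ≤ η * h := (le_abs_self _).trans
            ((((operatorSemigroup G h - 1 - (h : ℝ) • G) v).norm_coe_le_norm x).trans e2)
          linarith
        have e4 := hstep x hx v (hnn _ hk0) hvB
        have e5 := mul_le_mul_of_nonneg_left (hgen _ hk0 x hx) h.2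
        have := hP.markov h
        have e6 : ∫ y, v y ∂P h x - k * (2 * η * h) ≤ ∫ y, (P (k * h) y).real A ∂P h x := by
          have := hP.markov (k * h)
          have hconst : ∫ y, (v y - k * (2 * η * h)) ∂P h x
              = ∫ y, v y ∂P h x - k * (2 * η * h) := by
            rw [integral_sub (hP.integrable h x v) (integrable_const _)]
            simp
          rw [← hconst]
          refine integral_mono ((hP.integrable h x v).sub (integrable_const _)) ?_
            fun y => ih ((Nat.le_succ k).trans hk) y
          refine Integrable.of_bound (Measurable.of_discrete.aestronglyMeasurable) 1
            (Eventually.of_forall fun y => ?_)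
          rw [Real.norm_of_nonneg measureReal_nonneg]
          exact measureReal_le_one
        rw [hv1, hP1]
        push_cast
        change (h : ℝ) * G v x ≤ h * R.generator v x at e5
        linarith
      · rw [hzero _ (by positivity) x hx]
        have : (0 : ℝ) ≤ ((k + 1 : ℕ) : ℝ) * (2 * η * h) := by positivity
        linarith [measureReal_nonneg (μ := P ((k + 1 : ℕ) * h) x) (s := A)]
  have hfin := hind m le_rfl x
  rw [hmh, hmhR] at hfin
  have : (m : ℝ) * (2 * η * h) = ε := by
    have : (m : ℝ) * (2 * η * h) = 2 * η * (m * h) := by ring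
    rw [this, hmhR, hη_def]
    field_simp
  linarith

/-- Used with `S = R` to bound the minimal solution, and with `S` the rates of the larger process to
compare two processes. -/
theorem killedSemigroup_le (hP : R.IsTransitionSemigroup P) {S : BirthDeathRates} (N : ℕ)
    (A : Set ℕ) {f : ℕ →ᵇ ℝ} (hf : ∀ x, f x ≤ A.indicator 1 x) (hnn : ∀ x, 0 ≤ f x)
    (hz : ∀ x, N ≤ x → f x = 0)
    (hgen : ∀ t, 0 ≤ t → ∀ x < N, S.generator (S.killedSemigroup N t f) x
      ≤ R.generator (S.killedSemigroup N t f) x) (t : ℝ≥0) (x : ℕ) :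
    S.killedSemigroup N t f x ≤ (P t x).real A := by
  refine hP.operatorSemigroup_le (S.killedGenerator N) N A hf
    (fun t ht => (S.killedSemigroup_mem N ht hnn hz).1)
    (fun t ht => (S.killedSemigroup_mem N ht hnn hz).2) (fun t ht x hx => ?_) t x
  rw [killedGenerator_apply, if_pos hx]
  exact hgen t ht x hx

end IsTransitionSemigroup

/-! ### From killed semigroups to the minimal solution -/

/-- Conditioning the killed process on its first jump. -/
theorem killedSemigroup_apply_eq (R : BirthDeathRates) {N x : ℕ} (hx : x < N)
    (f : ℕ →ᵇ ℝ) (t : ℝ) :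
    R.killedSemigroup N t f x = Real.exp (-((R.birth x : ℝ) + R.death x) * t) * f x
      + ∫ s in (0 : ℝ)..t, Real.exp (-((R.birth x : ℝ) + R.death x) * s) *
          (R.birth x * R.killedSemigroup N (t - s) f (x + 1)
            + R.death x * R.killedSemigroup N (t - s) f (x - 1)) := by
  set q : ℝ := (R.birth x : ℝ) + R.death x with hq
  have hv : ∀ s, HasDerivAt (fun s => R.killedSemigroup N s f)
      (R.killedGenerator N (R.killedSemigroup N s f)) s :=
    fun s => hasDerivAt_operatorSemigroup_apply _ f s
  have hcont : ∀ z, Continuous fun s => R.killedSemigroup N s f z := fun z =>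
    (continuous_eval_const z).comp
      (continuous_iff_continuousAt.2 fun s => (hv s).continuousAt)
  have hvx : ∀ s, HasDerivAt (fun s => R.killedSemigroup N s f x)
      (R.generator (R.killedSemigroup N s f) x) s := by
    intro s
    have h := (BoundedContinuousFunction.evalCLM ℝ x).hasFDerivAt.comp_hasDerivAt s (hv s)
    have h2 : (BoundedContinuousFunction.evalCLM ℝ x) (R.killedGenerator N
        (R.killedSemigroup N s f)) = R.generator (R.killedSemigroup N s f) x := by
      change R.killedGenerator N (R.killedSemigroup N s f) x = _
      rw [killedGenerator_apply, if_pos hx]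
    rw [h2] at h
    exact h
  -- Variation of constants: differentiating the exponential cancels the holding term `-q * u` of
  -- the generator, leaving only the jump terms.
  have hderiv : ∀ s ∈ Set.uIcc 0 t,
      HasDerivAt (fun s => -(Real.exp (-q * s) * R.killedSemigroup N (t - s) f x))
        (Real.exp (-q * s) * (R.birth x * R.killedSemigroup N (t - s) f (x + 1)
            + R.death x * R.killedSemigroup N (t - s) f (x - 1))) s := by
    intro s _
    have h1 : HasDerivAt (fun s => Real.exp (-q * s)) (Real.exp (-q * s) * -q) s := by
      simpa using ((hasDerivAt_id s).const_mul (-q)).exp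
    have h2 : HasDerivAt (fun s => R.killedSemigroup N (t - s) f x)
        (-R.generator (R.killedSemigroup N (t - s) f) x) s := by
      simpa [Function.comp_def] using (hvx (t - s)).scomp s ((hasDerivAt_id s).const_sub t)
    refine (h1.mul h2).neg.congr_deriv ?_
    simp only [generator, hq]
    ring
  rw [intervalIntegral.integral_eq_sub_of_hasDerivAt hderiv]
  · simp [killedSemigroup, operatorSemigroup_zero]
  · refine Continuous.intervalIntegrable ?_ _ _
    have h1 := (hcont (x + 1)).comp (continuous_sub_left t)
    have h2 := (hcont (x - 1)).comp (continuous_sub_left t)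
    simp only [Function.comp_def] at h1 h2
    fun_prop

/-- The indicator function of a finite set of states. -/
noncomputable def finsetIndicator (s : Finset ℕ) : ℕ →ᵇ ℝ :=
  ∑ y ∈ s, BoundedContinuousFunction.indicator {y} (isClopen_discrete _)

theorem finsetIndicator_apply (s : Finset ℕ) (x : ℕ) :
    finsetIndicator s x = (s : Set ℕ).indicator 1 x := by
  have h : ∀ y, BoundedContinuousFunction.indicator {y} (isClopen_discrete {y}) x
      = if x = y then 1 else 0 := by
    intro y
    change Set.indicator {y} 1 x = _
    simp [Set.indicator_apply]
  rw [finsetIndicator, BoundedContinuousFunction.sum_apply]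
  simp [h, Set.indicator_apply]

theorem finsetIndicator_nonneg (s : Finset ℕ) (x : ℕ) : 0 ≤ finsetIndicator s x := by
  rw [finsetIndicator_apply]
  exact Set.indicator_nonneg (fun _ _ => zero_le_one) x

theorem finsetIndicator_eq_zero {s : Finset ℕ} {N : ℕ} (hs : ∀ y ∈ s, y < N) {x : ℕ}
    (hx : N ≤ x) : finsetIndicator s x = 0 := by
  rw [finsetIndicator_apply]
  exact Set.indicator_of_notMem (fun h => hx.not_gt (hs x h)) _

theorem finsetIndicator_range_succ_le (n x : ℕ) :
    finsetIndicator (Finset.range n) (x + 1) ≤ finsetIndicator (Finset.range n) x := by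
  simp only [finsetIndicator_apply, Set.indicator_apply, Finset.coe_range, Set.mem_Iio]
  split_ifs <;> first | omega | simp

/-- Paths with fewer than `n` jumps do not reach `N` from a state `x` with `x + n ≤ N`. -/
theorem fellerIter_le_killedSemigroup (R : BirthDeathRates) {N y : ℕ} (hy : y < N) (n : ℕ) :
    ∀ (t : ℝ) (x : ℕ), 0 ≤ t → x + n ≤ N →
      R.fellerIter y n t x ≤ ENNReal.ofReal (R.killedSemigroup N t (finsetIndicator {y}) x) := by
  have hnn : ∀ t, 0 ≤ t → ∀ x, 0 ≤ R.killedSemigroup N t (finsetIndicator {y}) x :=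
    fun t ht => (R.killedSemigroup_mem N ht (finsetIndicator_nonneg _)
      fun x hx => finsetIndicator_eq_zero (by simpa using hy) hx).1
  induction n with
  | zero => intro t x _ _; simp [fellerIter]
  | succ n ih =>
    intro t x ht hx
    rw [fellerIter, R.killedSemigroup_apply_eq (by omega : x < N)]
    set F : ℝ → ℝ := fun s => Real.exp (-((R.birth x : ℝ) + R.death x) * s) *
          (R.birth x * R.killedSemigroup N (t - s) (finsetIndicator {y}) (x + 1)
            + R.death x * R.killedSemigroup N (t - s) (finsetIndicator {y}) (x - 1)) with hF
    have hFnn : ∀ s ∈ Set.Icc 0 t, 0 ≤ F s := fun s hs =>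
      mul_nonneg (Real.exp_pos _).le (add_nonneg
        (mul_nonneg (NNReal.coe_nonneg _) (hnn _ (sub_nonneg.2 hs.2) _))
        (mul_nonneg (NNReal.coe_nonneg _) (hnn _ (sub_nonneg.2 hs.2) _)))
    have hFcont : Continuous F := by
      have hc : ∀ z, Continuous fun s => R.killedSemigroup N s (finsetIndicator {y}) z := fun z =>
        (continuous_eval_const z).comp
          (continuous_iff_continuousAt.2 fun s =>
            (hasDerivAt_operatorSemigroup_apply _ _ s).continuousAt)
      have h1 := (hc (x + 1)).comp (continuous_sub_left t)
      have h2 := (hc (x - 1)).comp (continuous_sub_left t)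
      simp only [Function.comp_def] at h1 h2
      fun_prop
    rw [ENNReal.ofReal_add (mul_nonneg (Real.exp_pos _).le (finsetIndicator_nonneg _ _))
      (intervalIntegral.integral_nonneg ht hFnn)]
    refine add_le_add ?_ ?_
    · split_ifs with hxy <;> simp [finsetIndicator_apply, hxy]
    · rw [intervalIntegral.integral_of_le ht, ← integral_Icc_eq_integral_Ioc,
        ofReal_integral_eq_lintegral_ofReal (hFcont.integrableOn_Icc)
          ((ae_restrict_iff' measurableSet_Icc).2 (Eventually.of_forall hFnn))]
      refine setLIntegral_mono' measurableSet_Icc fun s hs => ?_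
      have hts := sub_nonneg.2 hs.2
      rw [hF, ENNReal.ofReal_mul (Real.exp_pos _).le,
        ENNReal.ofReal_add (mul_nonneg (NNReal.coe_nonneg _) (hnn _ hts _))
          (mul_nonneg (NNReal.coe_nonneg _) (hnn _ hts _)),
        ENNReal.ofReal_mul (NNReal.coe_nonneg _), ENNReal.ofReal_mul (NNReal.coe_nonneg _),
        ENNReal.ofReal_coe_nnreal, ENNReal.ofReal_coe_nnreal]
      gcongr
      · exact ih _ _ hts (by omega)
      · exact ih _ _ hts (by omega)

theorem fellerIter_le_succ (R : BirthDeathRates) (y n : ℕ) :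
    ∀ (t : ℝ) (x : ℕ), R.fellerIter y n t x ≤ R.fellerIter y (n + 1) t x := by
  induction n with
  | zero => intro t x; simp [fellerIter]
  | succ n ih =>
    intro t x
    rw [fellerIter, fellerIter]
    gcongr <;> exact ih _ _

/-- Each Feller iterate sees finitely many jumps, so one large `N` serves all of `s`; linearity of
the killed semigroup then assembles the indicator of `s`. -/
theorem sum_minimalTransition_le (R : BirthDeathRates) (t : ℝ≥0) (x : ℕ) (s : Finset ℕ)
    {c : ℝ≥0∞} (hc : ∀ N, (∀ y ∈ s, y < N) →
      ENNReal.ofReal (R.killedSemigroup N t (finsetIndicator s) x) ≤ c) :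
    ∑ y ∈ s, R.minimalTransition t x y ≤ c := by
  simp only [minimalTransition]
  rw [ENNReal.finsetSum_iSup_of_monotone
    fun y => monotone_nat_of_le_succ fun n => R.fellerIter_le_succ y n t x]
  refine iSup_le fun n => ?_
  -- `N` lies above every element of `s` and out of reach of fewer than `n` jumps from `x`.
  set N := x + n + (s.sup id + 1) with hN
  have hs : ∀ y ∈ s, y < N := fun y hy => by
    have : y ≤ s.sup id := Finset.le_sup (f := id) hy
    omega
  refine le_trans ?_ (hc N hs)
  have hsum : R.killedSemigroup N t (finsetIndicator s) x
      = ∑ y ∈ s, R.killedSemigroup N t (finsetIndicator {y}) x := by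
    have : finsetIndicator s = ∑ y ∈ s, finsetIndicator {y} := by simp [finsetIndicator]
    rw [this, map_sum, BoundedContinuousFunction.sum_apply]
  have hnn : ∀ y ∈ s, 0 ≤ R.killedSemigroup N t (finsetIndicator {y}) x := fun y hy =>
    (R.killedSemigroup_mem N t.2
    (finsetIndicator_nonneg {y}) fun z hz =>
      finsetIndicator_eq_zero (by simpa using hs y hy) hz).1 x
  rw [hsum, ENNReal.ofReal_sum_of_nonneg hnn]
  exact Finset.sum_le_sum fun y hy =>
    R.fellerIter_le_killedSemigroup (hs y hy) n t x t.2 (by omega)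

/-! ### Uniqueness under non-explosion and comparison of tails -/

namespace IsTransitionSemigroup

variable {R : BirthDeathRates} {P : ℝ≥0 → Kernel ℕ ℕ}

/-- Every transition semigroup dominates the minimal solution. -/
theorem minimalTransition_le (hP : R.IsTransitionSemigroup P) (t : ℝ≥0) (x y : ℕ) :
    R.minimalTransition t x y ≤ P t x {y} := by
  have := hP.markov t
  have h := R.sum_minimalTransition_le t x {y} (c := P t x {y}) fun N hN => by
    rw [← ofReal_measureReal]
    refine ENNReal.ofReal_le_ofReal (hP.killedSemigroup_le N {y} (fun z => ?_)
      (finsetIndicator_nonneg _) (fun z hz => finsetIndicator_eq_zero hN hz)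
      (fun _ _ _ _ => le_rfl) t x)
    rw [finsetIndicator_apply, Finset.coe_singleton]
  simpa using h

/-- Both sides have total mass `1`, so the pointwise domination of the minimal solution cannot be
strict anywhere. -/
theorem measure_singleton_eq (hP : R.IsTransitionSemigroup P) (hR : R.NonExplosive) (t : ℝ≥0)
    (x y : ℕ) : P t x {y} = R.minimalTransition t x y := by
  have := hP.markov t
  by_contra hne
  have hlt : R.minimalTransition t x y < P t x {y} :=
    lt_of_le_of_ne (hP.minimalTransition_le t x y) (Ne.symm hne)
  have hsum : ∑' y, P t x {y} = 1 := by
    have h := (P t x).tsum_indicator_apply_singleton Set.univ MeasurableSet.univ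
    simpa using h
  have := ENNReal.tsum_lt_tsum (by rw [hR t x]; exact ENNReal.one_ne_top)
    (hP.minimalTransition_le t x) hlt
  rw [hR t x, hsum] at this
  exact lt_irrefl _ this

theorem measure_Iio_le {R' : BirthDeathRates} {P' : ℝ≥0 → Kernel ℕ ℕ}
    (hP : R.IsTransitionSemigroup P) (hP' : R'.IsTransitionSemigroup P') (hR : R.NonExplosive)
    (hbirth : ∀ n, R'.birth n ≤ R.birth n) (hdeath : ∀ n, R.death n ≤ R'.death n)
    (t : ℝ≥0) (x n : ℕ) : P t x (Set.Iio n) ≤ P' t x (Set.Iio n) := by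
  have := hP'.markov t
  have hcoe : Set.Iio n = (Finset.range n : Set ℕ) := by simp
  rw [hcoe, ← sum_measure_singleton]
  simp only [hP.measure_singleton_eq hR]
  refine R.sum_minimalTransition_le t x _ fun N hN => ?_
  rw [← ofReal_measureReal]
  have hz : ∀ z, N ≤ z → finsetIndicator (Finset.range n) z = 0 :=
    fun z hz => finsetIndicator_eq_zero hN hz
  exact ENNReal.ofReal_le_ofReal (hP'.killedSemigroup_le N _
    (fun z => (finsetIndicator_apply _ z).le) (finsetIndicator_nonneg _) hz
    (fun s hs y _ => generator_le_of_rates_le hbirth hdeath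
      (R.killedSemigroup_succ_le N hs (finsetIndicator_nonneg _) hz
        (finsetIndicator_range_succ_le n)) y) t x)

theorem measure_Ici_le {R' : BirthDeathRates} {P' : ℝ≥0 → Kernel ℕ ℕ}
    (hP : R.IsTransitionSemigroup P) (hP' : R'.IsTransitionSemigroup P') (hR : R.NonExplosive)
    (hbirth : ∀ n, R'.birth n ≤ R.birth n) (hdeath : ∀ n, R.death n ≤ R'.death n)
    (t : ℝ≥0) (x n : ℕ) : P' t x (Set.Ici n) ≤ P t x (Set.Ici n) := by
  have := hP.markov t
  have := hP'.markov t
  rw [← Set.compl_Iio, prob_compl_eq_one_sub measurableSet_Iio,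
    prob_compl_eq_one_sub measurableSet_Iio]
  exact tsub_le_tsub_left (hP.measure_Iio_le hP' hR hbirth hdeath t x n) _

end IsTransitionSemigroup

/-- The law of a birth-death process at a given time. -/
theorem IsProcessFrom.exists_map_eq {R : BirthDeathRates} {x : ℕ} {Ω : Type*} [MeasurableSpace Ω]
    {μ : Measure Ω} [IsProbabilityMeasure μ] {X : ℝ≥0 → Ω → ℕ} (hX : R.IsProcessFrom x μ X) :
    ∃ P : ℝ≥0 → Kernel ℕ ℕ, R.IsTransitionSemigroup P ∧ ∀ t, μ.map (X t) = P t x := by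
  obtain ⟨P, hP, hmarkov⟩ := hX.markov
  refine ⟨P, hP, fun t => Measure.ext_of_singleton fun y => ?_⟩
  have := hP.markov t
  have hm : (⨆ u : Set.Iic (0 : ℝ≥0), MeasurableSpace.comap (X u) inferInstance)
      ≤ (inferInstance : MeasurableSpace Ω) :=
    iSup_le fun u => (hX.measurable u).comap_le
  have hmeas : MeasurableSet (X t ⁻¹' {y}) := hX.measurable t (MeasurableSet.singleton y)
  -- Taking expectations in the Markov property at time `0` gives the one-dimensional law, since `X
  -- 0 = x` almost surely.
  have h1 := integral_condExp (μ := μ) (f := (X (0 + t) ⁻¹' {y}).indicator fun _ => (1 : ℝ)) hm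
  rw [integral_congr_ae (hmarkov 0 t y), zero_add, integral_indicator_const _ hmeas] at h1
  have h2 : ∫ ω, (P t (X 0 ω)).real {y} ∂μ = (P t x).real {y} := by
    rw [integral_congr_ae (g := fun _ => (P t x).real {y})]
    · simp
    · filter_upwards [hX.start] with ω hω
      rw [hω]
  rw [h2, smul_eq_mul, mul_one] at h1
  rw [Measure.map_apply (hX.measurable t) (MeasurableSet.singleton y)]
  exact (measureReal_eq_measureReal_iff).1 h1.symm

end BirthDeathRates

/-- Layer-cake formula: the superlevel sets of a nondecreasing function on `ℕ` are empty or of the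
form `Set.Ici n`. -/
theorem lintegral_ofReal_le_of_measure_Ici_le {μ ν : Measure ℕ}
    (h : ∀ n, μ (Set.Ici n) ≤ ν (Set.Ici n)) {f : ℕ → ℝ} (hnn : ∀ n, 0 ≤ f n)
    (hf : Monotone f) :
    ∫⁻ n, ENNReal.ofReal (f n) ∂μ ≤ ∫⁻ n, ENNReal.ofReal (f n) ∂ν := by
  rw [lintegral_eq_lintegral_meas_le μ (Eventually.of_forall hnn)
      Measurable.of_discrete.aemeasurable,
    lintegral_eq_lintegral_meas_le ν (Eventually.of_forall hnn)
      Measurable.of_discrete.aemeasurable]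
  refine lintegral_mono fun c => ?_
  -- The empty case is separate because `sInf ∅ = 0` would give all of `ℕ`.
  rcases Set.eq_empty_or_nonempty {a : ℕ | c ≤ f a} with hempty | hne
  · simp [hempty]
  · have hIci : {a : ℕ | c ≤ f a} = Set.Ici (sInf {a : ℕ | c ≤ f a}) := by
      ext a
      exact ⟨fun ha => Nat.sInf_le ha, fun ha => (Nat.sInf_mem hne).trans (hf ha)⟩
    rw [hIci]
    exact h _

theorem mainTheorem9 (R R' : BirthDeathRates) (hR : R.NonExplosive)
    (hbirth : ∀ n, R'.birth n ≤ R.birth n) (hdeath : ∀ n, R.death n ≤ R'.death n)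
    (x : ℕ)
    {Ω : Type*} [MeasurableSpace Ω] (μ : Measure Ω) [IsProbabilityMeasure μ]
    (X : ℝ≥0 → Ω → ℕ) (hX : R.IsProcessFrom x μ X)
    {Ω' : Type*} [MeasurableSpace Ω'] (μ' : Measure Ω') [IsProbabilityMeasure μ']
    (X' : ℝ≥0 → Ω' → ℕ) (hX' : R'.IsProcessFrom x μ' X')
    (t : ℝ≥0) :
    StochasticallySmaller μ' (X' t) μ (X t) := by
  intro f hnn hf
  obtain ⟨P, hP, hlaw⟩ := hX.exists_map_eq
  obtain ⟨P', hP', hlaw'⟩ := hX'.exists_map_eq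
  have hg : Measurable fun n => ENNReal.ofReal (f n) := Measurable.of_discrete
  rw [← lintegral_map hg (hX'.measurable t), ← lintegral_map hg (hX.measurable t), hlaw, hlaw']
  exact lintegral_ofReal_le_of_measure_Ici_le
    (hP.measure_Ici_le hP' hR hbirth hdeath t x) hnn hf
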